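/- Let $R$ be a noetherian regular integral domain with quotient field $K$, let $X=\operatorname{Spec}R$, let $X_1$ be the set of prime ideals of $R$ of height $1$, and let $\alpha,\beta\in R$ be nonzero. For $n\ge 1$ invertible in $R$ and a primitive $n$-th root of unity $\zeta\in R$, the symbol algebra $(\alpha,\beta)_n$ is the associative $K$-algebra generated by $u,v$ with relations $u^n=\alpha$, $v^n=\beta$, $uv=\zeta vu$. The divisor of $\alpha$ is the set of $x\in X_1$ at which $\alpha$ has nonzero valuation. Let $B$ be a central simple $K$-algebra and let $x\in X_1$ be such that $\dim_K B$ is prime to the characteristic of the residue field $k(x)$. Let $\mathcal O^\nu\subset K^\nu$ be the completions of the discrete valuation ring $R_x$ and of $K$, let $D^\nu$ be the division algebra with $B\otimes_K K^\nu\cong M_m(D^\nu)$ for some $m\geq 1$, let $A$ be a maximal $\mathcal O^\nu$-order in $D^\nu$, and let $L$ be the center of $A/\operatorname{rad}A$, where $\operatorname{rad}A$ is the Jacobson radical; then $x$ belongs to the ramification divisor of $B$ if and only if the field extension $L/k(x)$ is nontrivial. (a) If $2$ is invertible in $R$ and $\alpha$ is a square modulo $\beta$ (that is, $\alpha\equiv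 c^2 \pmod{\beta R}$ for some $c\in R$), then the ramification divisor of the symbol algebra $(\alpha,\beta)_2$ (with $\zeta=-1$) is a subset of the divisor of $\alpha$. (b) For every prime number $q$ that is invertible in $R$: if $R$ contains a primitive $q$-th root of unity $\zeta$ and $\alpha$ is a $q$-th power modulo $\beta$ (that is, $\alpha\equiv c^q\pmod{\beta R}$ for some $c\in R$), then the ramification divisor of the symbol algebra $(\alpha,\beta)_q$, formed with $\zeta$, is a subset of the divisor of $\alpha$. -/

import Mathlib

open scoped TensorProduct

universe u v w

/-! ### Symbol algebras -/

section SymbolAlgebra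

variable (K : Type v) [Field K]

/-- The defining relations `uⁿ = a`, `vⁿ = b`, `u v = ζ v u`, where `u`, `v` are the free
generators number `0` and `1`. -/
inductive SymbolRel (n : ℕ) (ζ a b : K) : FreeAlgebra K (Fin 2) → FreeAlgebra K (Fin 2) → Prop
  | u_pow : SymbolRel n ζ a b (FreeAlgebra.ι K 0 ^ n) (algebraMap K _ a)
  | v_pow : SymbolRel n ζ a b (FreeAlgebra.ι K 1 ^ n) (algebraMap K _ b)
  | comm : SymbolRel n ζ a b (FreeAlgebra.ι K 0 * FreeAlgebra.ι K 1)
      (ζ • (FreeAlgebra.ι K 1 * FreeAlgebra.ι K 0))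

/-- The symbol algebra `(a, b)_n` over `K` (with respect to `ζ`): the associative `K`-algebra
generated by `u`, `v` subject to `uⁿ = a`, `vⁿ = b`, `u v = ζ v u`. -/
abbrev SymbolAlgebra (n : ℕ) (ζ a b : K) : Type v := RingQuot (SymbolRel K n ζ a b)

end SymbolAlgebra

/-! ### Orders, the division algebra component -/

section Orders

variable (S : Type u) (F : Type v) [CommRing S] [Field F] [Algebra S F]

/-- An `S`-order in the `F`-algebra `D`: an `S`-subalgebra that is a finitely generated `S`-module
and spans `D` over `F`. -/
structure IsOrderIn {D : Type w} [Ring D] [Algebra F D] [Algebra S D] [IsScalarTower S F D]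
    (A : Subalgebra S D) : Prop where
  finite : Module.Finite S A
  span_eq_top : Submodule.span F (A : Set D) = ⊤

/-- A maximal `S`-order in the `F`-algebra `D`. -/
def IsMaximalOrderIn {D : Type w} [Ring D] [Algebra F D] [Algebra S D] [IsScalarTower S F D]
    (A : Subalgebra S D) : Prop :=
  Maximal (IsOrderIn S F) A

/-- `D` is the division algebra component of the `F`-algebra `B`: `B ≅ Mₙ(D)`, `n ≥ 1`. -/
def IsDivisionComponent (F : Type v) [Field F] (B : Type w) [Ring B] [Algebra F B]
    (D : Type v) [DivisionRing D] [Algebra F D] : Prop :=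
  ∃ n : ℕ, n ≠ 0 ∧ Nonempty (B ≃ₐ[F] Matrix (Fin n) (Fin n) D)

/-- The residue extension `L` of an order `A`: the center of the algebra `A / rad A` of residue
classes. The image of the residue field of the local ring `S` in it is `⊥`. -/
def residueExtension {D : Type w} [Ring D] [Algebra S D] (A : Subalgebra S D) :
    Subalgebra S (A ⧸ Ring.jacobson A) :=
  Subalgebra.center S (A ⧸ Ring.jacobson A)

end Orders

/-! ### Ramification at a discrete valuation -/

section DVR

variable (O : Type u) [CommRing O] [IsDomain O] [IsDiscreteValuationRing O]
variable (K : Type v) [Field K] [Algebra O K] [IsFractionRing O K]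

/-- The completion `K^ν` of the fraction field of a discrete valuation ring. -/
noncomputable abbrev CompletedField : Type v :=
  (IsDiscreteValuationRing.maximalIdeal O).adicCompletion K

/-- The valuation ring of `K^ν`, that is, the completion of `O`. -/
noncomputable abbrev CompletedRing : ValuationSubring (CompletedField O K) :=
  (IsDiscreteValuationRing.maximalIdeal O).adicCompletionIntegers K

/-- The central simple `K`-algebra `B` is ramified along the discrete valuation `ν` of `K` with
valuation ring `O`: if `D` is the division algebra component of `K^ν ⊗ B` and `A` is a maximal
order of `D`, then the center `L` of `A / rad A` is strictly larger than the residue field.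
(`D` is unique up to isomorphism and `A` up to conjugation, so that the choices of
`D` and `A` do not matter.) -/
def IsRamifiedAlong (B : Type w) [Ring B] [Algebra K B] : Prop :=
  ∃ (D : Type v) (_ : DivisionRing D) (_ : Algebra (CompletedField O K) D)
    (_ : Algebra (CompletedRing O K) D)
    (_ : IsScalarTower (CompletedRing O K) (CompletedField O K) D),
    IsDivisionComponent (CompletedField O K) (CompletedField O K ⊗[K] B) D ∧
    ∃ A : Subalgebra (CompletedRing O K) D,
      IsMaximalOrderIn (CompletedRing O K) (CompletedField O K) A ∧
      residueExtension (CompletedRing O K) A ≠ ⊥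

end DVR

/-! ### Points of codimension one and divisors -/

section Divisors

variable (R : Type u) [CommRing R]

/-- The set `X₁` of points of codimension one of `X = Spec R`: the primes of height one. -/
abbrev CodimOnePoint : Type u := {p : PrimeSpectrum R // p.asIdeal.height = 1}

variable [IsDomain R] (K : Type v) [Field K] [Algebra R K] [IsFractionRing R K]

/-- The local ring of `X = Spec R` at `x`, inside the fraction field `K`. -/
noncomputable abbrev localRingAt (x : CodimOnePoint R) : Subalgebra R K :=
  Localization.subalgebra.ofField K x.1.asIdeal.primeCompl
    x.1.asIdeal.primeCompl_le_nonZeroDivisors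

instance localRingAt_isDiscreteValuationRing [IsRegularRing R] (x : CodimOnePoint R) :
    IsDiscreteValuationRing (localRingAt R K x) := by
  let e := IsLocalization.algEquiv x.1.asIdeal.primeCompl
    (Localization.AtPrime x.1.asIdeal) (localRingAt R K x)
  have hreg : IsRegularLocalRing (localRingAt R K x) :=
    IsRegularLocalRing.of_ringEquiv e.toRingEquiv
  have : IsLocalization.AtPrime (localRingAt R K x) x.1.asIdeal :=
    inferInstanceAs (IsLocalization x.1.asIdeal.primeCompl _)
  have hdim : ringKrullDim (localRingAt R K x) = 1 := by
    rw [IsLocalization.AtPrime.ringKrullDim_eq_height x.1.asIdeal, x.2]; rfl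
  have hfin := (IsRegularLocalRing.iff_finrank_cotangentSpace _).mp hreg
  rw [hdim] at hfin
  have hnf : ¬ IsField (localRingAt R K x) := fun h => by
    rw [ringKrullDim_eq_zero_of_isField h] at hdim
    exact zero_ne_one hdim
  exact ((IsDiscreteValuationRing.TFAE (localRingAt R K x) hnf).out 0 5).mpr
    (by exact_mod_cast hfin)

variable [IsRegularRing R]

/-- The ramification divisor of the central simple `K`-algebra `B` on `X = Spec R`: the set of
points of codimension one along which `B` ramifies. -/
def ramificationDivisor (B : Type w) [Ring B] [Algebra K B] : Set (CodimOnePoint R) :=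
  {x | IsRamifiedAlong (localRingAt R K x) K B}

/-- The divisor of `a` on `X = Spec R`: the set of points `x` of codimension one such that `a` has
nonzero valuation at `x`. (Valuations are written multiplicatively here.) -/
def divisorOf (a : K) : Set (CodimOnePoint R) :=
  {x | (IsDiscreteValuationRing.maximalIdeal (localRingAt R K x)).valuation K a ≠ 1}

end Divisors

/-! Fix a height one prime at which `α` is a unit, with completed valuation ring `O` and completed
field `F`. Ramification is witnessed by some choice of `D` and `A`, so the residue extension has to
be shown trivial for every choice.

Over `F` the symbol algebra has dimension `q²` and is `M_m(D)`, so `m² · dim D = q²` and, `q` being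
prime, either `D = F` or the algebra is `D` itself. If `D = F`, an order consists of integral
elements of `F`, hence of scalars from `O`. If the algebra is `D`, then `β` must be a unit of `O`:
otherwise `α` is a `q`-th power in the residue field, hence in `O` by Hensel's lemma, and `u^q -
r^q` factors into zero divisors (`slot_ne_pow`).

With both slots units, `Λ = O[u, v]` is simple modulo the uniformizer `π`. As `Λ` is a domain and
idempotents lift, `Λ/πΛ` is a division ring, so every element outside `πΛ` is a unit
(`eq_smul_or_isUnit`). Hence `Λ` is the only maximal order (`eq_adjoin_of_isMaximalOrderIn`). Its
quotient by the radical is again generated by a symbol pair with unit slots, so its center is the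
image of `O` (`center_eq_bot`).

All computations with monomials rest on one device: conjugations by `u` and `v` act on `vⁱ uʲ` by
`zⁱ` and `zʲ`, and differences of these eigenvalues are units because `q` is invertible. -/

/-! ### Symbol pairs over a commutative ring -/

section SymbolPair

/-- If `∑ xᵢ` lies in a submodule stable under an endomorphism `φ`, and the `xᵢ` are
eigenvectors of `φ` whose eigenvalues differ by units, then every `xᵢ` lies in the submodule. -/
theorem Submodule.mem_of_sum_eigenvectors_mem {S M ι : Type*} [CommRing S] [AddCommGroup M]
    [Module S M] (φ : M →ₗ[S] M) (N : Submodule S M) (hN : ∀ x ∈ N, φ x ∈ N) (μ : ι → S)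
    (s : Finset ι) (hμ : (s : Set ι).Pairwise fun i j => IsUnit (μ i - μ j)) :
    ∀ x : ι → M, (∀ i ∈ s, φ (x i) = μ i • x i) → ∑ i ∈ s, x i ∈ N → ∀ i ∈ s, x i ∈ N := by
  classical
  induction s using Finset.induction_on with
  | empty => simp
  | insert k s hk ih =>
    intro x hx hsum
    have hs : ∀ i ∈ s, x i ∈ N := by
      intro i hi
      -- Applying `φ - μ k` kills `x k` and scales each other summand by a unit, which is divided
      -- out after the induction hypothesis.
      have hmem : ∑ j ∈ s, (μ j - μ k) • x j ∈ N := by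
        have h1 := N.sub_mem (hN _ hsum) (N.smul_mem (μ k) hsum)
        rw [map_sum, Finset.smul_sum, ← Finset.sum_sub_distrib, Finset.sum_insert hk,
          hx k (Finset.mem_insert_self k s), sub_self, zero_add] at h1
        convert h1 using 1
        refine Finset.sum_congr rfl fun j hj => ?_
        rw [hx j (Finset.mem_insert_of_mem hj), sub_smul]
      have h2 := ih (hμ.mono (by simp)) (fun j => (μ j - μ k) • x j)
        (fun j hj => by
          rw [map_smul, hx j (Finset.mem_insert_of_mem hj), smul_comm]) hmem i hi
      have hu : IsUnit (μ i - μ k) := hμ (by simp [hi]) (by simp) (by rintro rfl; exact hk hi)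
      obtain ⟨w, hw⟩ := hu
      have h3 := N.smul_mem (↑w⁻¹ : S) h2
      simpa only [← hw, smul_smul, Units.inv_mul, one_smul] using h3
    intro i hi
    rcases Finset.mem_insert.mp hi with rfl | hi
    · rw [Finset.sum_insert hk] at hsum
      exact (N.add_mem_iff_left (N.sum_mem hs)).mp hsum
    · exact hs i hi

/-- Elements `u`, `v` of an algebra subject to the relations of the symbol algebra. -/
structure IsSymbolPair {S E : Type*} [CommRing S] [Ring E] [Algebra S E] (q : ℕ) (z a b : S)
    (u v : E) : Prop where
  u_pow : u ^ q = algebraMap S E a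
  v_pow : v ^ q = algebraMap S E b
  comm : u * v = z • (v * u)

namespace IsSymbolPair

variable {S E E' : Type*} [CommRing S] [Ring E] [Algebra S E] [Ring E'] [Algebra S E']
  {q : ℕ} {z a b : S} {u v : E}

theorem map (h : IsSymbolPair q z a b u v) (f : E →ₐ[S] E') :
    IsSymbolPair q z a b (f u) (f v) where
  u_pow := by rw [← map_pow, h.u_pow, AlgHom.commutes]
  v_pow := by rw [← map_pow, h.v_pow, AlgHom.commutes]
  comm := by rw [← map_mul, h.comm, map_smul, map_mul]

theorem isUnit_left (h : IsSymbolPair q z a b u v) (hq : q ≠ 0) (ha : IsUnit a) : IsUnit u :=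
  (isUnit_pow_iff hq).mp (h.u_pow ▸ ha.map (algebraMap S E))

theorem isUnit_right (h : IsSymbolPair q z a b u v) (hq : q ≠ 0) (hb : IsUnit b) : IsUnit v :=
  (isUnit_pow_iff hq).mp (h.v_pow ▸ hb.map (algebraMap S E))

theorem left_mul_pow (h : IsSymbolPair q z a b u v) (i : ℕ) :
    u * v ^ i = z ^ i • (v ^ i * u) := by
  induction i with
  | zero => simp
  | succ i ih =>
    rw [pow_succ, ← mul_assoc, ih, smul_mul_assoc, mul_assoc, h.comm, mul_smul_comm, smul_smul,
      ← pow_succ, ← mul_assoc]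

theorem pow_mul_right (h : IsSymbolPair q z a b u v) (j : ℕ) :
    u ^ j * v = z ^ j • (v * u ^ j) := by
  induction j with
  | zero => simp
  | succ j ih =>
    rw [pow_succ, mul_assoc, h.comm, mul_smul_comm, ← mul_assoc, ih, smul_mul_assoc, smul_smul,
      mul_assoc, ← pow_succ, ← pow_succ']

/-- The subalgebra generated by `u` and `v` is spanned by the monomials `vⁱ uʲ`, `i, j < q`. -/
theorem exists_eq_sum (h : IsSymbolPair q z a b u v) (hq : q ≠ 0) {x : E}
    (hx : x ∈ Algebra.adjoin S {u, v}) :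
    ∃ c : ℕ → ℕ → S,
      x = ∑ i ∈ Finset.range q, ∑ j ∈ Finset.range q, c i j • (v ^ i * u ^ j) := by
  set W := Submodule.span S
    (Set.range fun p : Fin q × Fin q => v ^ (p.1 : ℕ) * u ^ (p.2 : ℕ)) with hW
  have hmon : ∀ i < q, ∀ j < q, v ^ i * u ^ j ∈ W := fun i hi j hj =>
    Submodule.subset_span ⟨(⟨i, hi⟩, ⟨j, hj⟩), rfl⟩
  have hu : ∀ y ∈ W, u * y ∈ W := by
    intro y hy
    induction hy using Submodule.span_induction with
    | mem y hy =>
      obtain ⟨⟨i, j⟩, rfl⟩ := hy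
      rw [← mul_assoc, h.left_mul_pow, smul_mul_assoc, mul_assoc, ← pow_succ']
      refine W.smul_mem _ ?_
      rcases Nat.lt_or_ge (j + 1 : ℕ) q with hj | hj
      · exact hmon _ i.2 _ hj
      · rw [show (j : ℕ) + 1 = q by omega, h.u_pow, ← Algebra.commutes, ← Algebra.smul_def]
        exact W.smul_mem _ (by simpa using hmon _ i.2 0 (by omega))
    | zero => simp
    | add y y' _ _ hy hy' => rw [mul_add]; exact W.add_mem hy hy'
    | smul c y _ hy => rw [mul_smul_comm]; exact W.smul_mem _ hy
  have hv : ∀ y ∈ W, v * y ∈ W := by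
    intro y hy
    induction hy using Submodule.span_induction with
    | mem y hy =>
      obtain ⟨⟨i, j⟩, rfl⟩ := hy
      rw [← mul_assoc, ← pow_succ']
      rcases Nat.lt_or_ge (i + 1 : ℕ) q with hi | hi
      · exact hmon _ hi _ j.2
      · rw [show (i : ℕ) + 1 = q by omega, h.v_pow, ← Algebra.smul_def]
        exact W.smul_mem _ (by simpa using hmon 0 (by omega) _ j.2)
    | zero => simp
    | add y y' _ _ hy hy' => rw [mul_add]; exact W.add_mem hy hy'
    | smul c y _ hy => rw [mul_smul_comm]; exact W.smul_mem _ hy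
  -- Left multiplication by the generators preserves `W`, so left multiplication by `x` does too; it
  -- is then applied to `1 ∈ W`.
  have hmul : ∀ y ∈ W, x * y ∈ W := by
    induction hx using Algebra.adjoin_induction with
    | mem x hx =>
      rcases hx with rfl | rfl
      · exact hu
      · exact hv
    | algebraMap r => exact fun y hy => by rw [← Algebra.smul_def]; exact W.smul_mem _ hy
    | add x x' _ _ hx hx' => exact fun y hy => by rw [add_mul]; exact W.add_mem (hx y hy) (hx' y hy)
    | mul x x' _ _ hx hx' => exact fun y hy => by rw [mul_assoc]; exact hx _ (hx' y hy)
  have hxW : x ∈ W := by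
    have := hmul 1 (by simpa using hmon 0 (by omega) 0 (by omega))
    rwa [mul_one] at this
  obtain ⟨c, hc⟩ := (Submodule.mem_span_range_iff_exists_fun S).mp hxW
  refine ⟨fun i j => if hij : i < q ∧ j < q then c (⟨i, hij.1⟩, ⟨j, hij.2⟩) else 0, ?_⟩
  rw [← hc, Fintype.sum_prod_type, Finset.sum_range]
  refine Finset.sum_congr rfl fun i _ => ?_
  rw [Finset.sum_range]
  refine Finset.sum_congr rfl fun j _ => ?_
  simp

/-- Conjugation by `u` sees only the exponent of `v`, and conjugation by `v` only that of `u`;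
together they separate all monomials. -/
theorem conj_left {U : Eˣ} (h : IsSymbolPair q z a b (U : E) v) (i j : ℕ) :
    (U : E) * (v ^ i * (U : E) ^ j) * (↑U⁻¹ : E) = z ^ i • (v ^ i * (U : E) ^ j) := by
  have hc : (U : E) ^ j * (↑U⁻¹ : E) = (↑U⁻¹ : E) * (U : E) ^ j :=
    ((Commute.refl (U : E)).units_inv_right.pow_left j).eq
  rw [← mul_assoc, h.left_mul_pow, smul_mul_assoc, smul_mul_assoc, mul_assoc, hc, mul_assoc,
    ← mul_assoc (U : E), Units.mul_inv, one_mul]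

theorem conj_right {V : Eˣ} (h : IsSymbolPair q z a b u (V : E)) (i j : ℕ) :
    (↑V⁻¹ : E) * ((V : E) ^ i * u ^ j) * (V : E) = z ^ j • ((V : E) ^ i * u ^ j) := by
  have hc : (V : E) ^ i * (V : E) = (V : E) * (V : E) ^ i := (pow_mul_comm' _ _)
  rw [mul_assoc, mul_assoc, h.pow_mul_right, mul_smul_comm, mul_smul_comm, ← mul_assoc _ (V : E),
    hc, mul_assoc, ← mul_assoc, Units.inv_mul, one_mul]

variable (hz : (Finset.range q : Set ℕ).Pairwise fun i j => IsUnit (z ^ i - z ^ j))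

include hz in
/-- If a linear combination of the monomials `vⁱ uʲ` lies in a two-sided ideal, then so do
its coefficients. -/
theorem algebraMap_mem_of_sum_mem (h : IsSymbolPair q z a b u v) (ha : IsUnit a) (hb : IsUnit b)
    (N : Submodule S E) (hN : ∀ x ∈ N, ∀ r s : E, r * x * s ∈ N) (c : ℕ → ℕ → S)
    (hc : ∑ i ∈ Finset.range q, ∑ j ∈ Finset.range q, c i j • (v ^ i * u ^ j) ∈ N)
    {i j : ℕ} (hi : i < q) (hj : j < q) : algebraMap S E (c i j) ∈ N := by
  have hq : q ≠ 0 := by omega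
  obtain ⟨U, rfl⟩ := h.isUnit_left hq ha
  obtain ⟨V, rfl⟩ := h.isUnit_right hq hb
  -- Conjugation by `U` isolates the terms with a fixed `i`; conjugation by `V⁻¹` then isolates a
  -- single monomial, which is a unit and can be cancelled.
  have h1 := N.mem_of_sum_eigenvectors_mem
    (LinearMap.mulLeft S (U : E) ∘ₗ LinearMap.mulRight S (↑U⁻¹ : E))
    (fun x hx => by simpa [mul_assoc] using hN x hx U (↑U⁻¹ : E)) (fun i => z ^ i)
    (Finset.range q) hz _ (fun i _ => by
      simp only [LinearMap.comp_apply, LinearMap.mulLeft_apply, LinearMap.mulRight_apply,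
        Finset.sum_mul, Finset.mul_sum, Finset.smul_sum]
      refine Finset.sum_congr rfl fun j _ => ?_
      rw [smul_mul_assoc, mul_smul_comm, smul_comm (z ^ i), ← mul_assoc, h.conj_left])
    hc i (by simpa)
  have h2 := N.mem_of_sum_eigenvectors_mem
    (LinearMap.mulLeft S (↑V⁻¹ : E) ∘ₗ LinearMap.mulRight S (V : E))
    (fun x hx => by simpa [mul_assoc] using hN x hx (↑V⁻¹ : E) V) (fun j => z ^ j)
    (Finset.range q) hz _ (fun j _ => by
      simp only [LinearMap.comp_apply, LinearMap.mulLeft_apply, LinearMap.mulRight_apply]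
      rw [smul_mul_assoc, mul_smul_comm, smul_comm (z ^ j), ← mul_assoc, h.conj_right])
    h1 j (by simpa)
  have h3 := hN _ h2 (↑(V ^ i)⁻¹ : E) (↑(U ^ j)⁻¹ : E)
  rw [mul_smul_comm, smul_mul_assoc, ← Units.val_pow_eq_pow_val, ← Units.val_pow_eq_pow_val,
    ← mul_assoc, Units.inv_mul, one_mul, Units.mul_inv] at h3
  rwa [Algebra.algebraMap_eq_smul_one]

include hz in
/-- An algebra generated by a symbol pair is central. -/
theorem center_eq_bot (h : IsSymbolPair q z a b u v) (hq : q ≠ 0) (ha : IsUnit a) (hb : IsUnit b)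
    (htop : Algebra.adjoin S {u, v} = ⊤) : Subalgebra.center S E = ⊥ := by
  refine eq_bot_iff.mpr fun x hx => ?_
  rw [Subalgebra.mem_center_iff] at hx
  obtain ⟨c, hc⟩ := h.exists_eq_sum hq (x := x) (htop ▸ Algebra.mem_top)
  have hunit : ∀ i, 0 < i → i < q → IsUnit (z ^ i - 1) := fun i h0 hi => by
    simpa using hz (x := i) (by simpa) (y := 0) (by simpa using Nat.pos_of_ne_zero hq) h0.ne'
  have hN : ∀ x ∈ (⊥ : Submodule S E), ∀ r s : E, r * x * s ∈ (⊥ : Submodule S E) := by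
    rintro x hx r s
    rw [Submodule.mem_bot] at hx
    simp [hx]
  have key1 : ∀ i j, 0 < i → i < q → j < q → algebraMap S E (c i j) = 0 := by
    intro i j h0 hi hj
    obtain ⟨U, rfl⟩ := h.isUnit_left hq ha
    -- The vanishing difference has coefficients `(z ^ i - 1) * c i j`, and `z ^ i - 1` is a unit
    -- for `0 < i < q`.
    have h1 : (U : E) * x * (↑U⁻¹ : E) - x = 0 := by
      rw [hx, mul_assoc, Units.mul_inv, mul_one, sub_self]
    have h2 := h.algebraMap_mem_of_sum_mem hz ha hb ⊥ hN (fun i j => (z ^ i - 1) * c i j)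
      (i := i) (j := j) (by
        rw [Submodule.mem_bot, ← h1, hc]
        simp only [Finset.sum_mul, Finset.mul_sum, ← Finset.sum_sub_distrib]
        refine Finset.sum_congr rfl fun i _ => Finset.sum_congr rfl fun j _ => ?_
        rw [mul_smul_comm, smul_mul_assoc, h.conj_left, smul_smul, ← sub_smul]
        congr 1
        ring) hi hj
    rw [Submodule.mem_bot, map_mul] at h2
    exact ((hunit i h0 hi).map (algebraMap S E)).mul_right_eq_zero.mp h2
  have key2 : ∀ i j, i < q → 0 < j → j < q → algebraMap S E (c i j) = 0 := by
    intro i j hi h0 hj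
    obtain ⟨V, rfl⟩ := h.isUnit_right hq hb
    have h1 : (↑V⁻¹ : E) * x * (V : E) - x = 0 := by
      rw [hx, mul_assoc, Units.inv_mul, mul_one, sub_self]
    have h2 := h.algebraMap_mem_of_sum_mem hz ha hb ⊥ hN (fun i j => (z ^ j - 1) * c i j)
      (i := i) (j := j) (by
        rw [Submodule.mem_bot, ← h1, hc]
        simp only [Finset.sum_mul, Finset.mul_sum, ← Finset.sum_sub_distrib]
        refine Finset.sum_congr rfl fun i _ => Finset.sum_congr rfl fun j _ => ?_
        rw [mul_smul_comm, smul_mul_assoc, h.conj_right, smul_smul, ← sub_smul]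
        congr 1
        ring) hi hj
    rw [Submodule.mem_bot, map_mul] at h2
    exact ((hunit j h0 hj).map (algebraMap S E)).mul_right_eq_zero.mp h2
  have hpos := Nat.pos_of_ne_zero hq
  rw [Algebra.mem_bot]
  refine ⟨c 0 0, ?_⟩
  rw [hc, Finset.sum_eq_single_of_mem 0 (by simpa), Finset.sum_eq_single_of_mem 0 (by simpa)]
  · rw [pow_zero, pow_zero, mul_one, Algebra.algebraMap_eq_smul_one]
  · intro j hj hj0
    rw [Algebra.smul_def, key2 0 j hpos (by omega) (by simpa using hj), zero_mul]
  · intro i hi hi0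
    refine Finset.sum_eq_zero fun j hj => ?_
    rw [Algebra.smul_def, key1 i j (by omega) (by simpa using hi) (by simpa using hj), zero_mul]

end IsSymbolPair

end SymbolPair

/-! ### Symbol pairs over a field: dimension and zero divisors -/

namespace IsSymbolPair

variable {F E : Type*} [Field F] [Ring E] [Algebra F E] {q : ℕ} {z a b : F} {u v : E}

/-- The monomials are independent because extracting coefficients, applied to the zero ideal, turns
a linear relation into vanishing coefficients. -/
theorem finrank_eq [Nontrivial E]
    (hz : (Finset.range q : Set ℕ).Pairwise fun i j => IsUnit (z ^ i - z ^ j))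
    (h : IsSymbolPair q z a b u v) (hq : q ≠ 0) (ha : a ≠ 0) (hb : b ≠ 0)
    (htop : Algebra.adjoin F {u, v} = ⊤) : Module.finrank F E = q * q := by
  let m : Fin q × Fin q → E := fun p => v ^ (p.1 : ℕ) * u ^ (p.2 : ℕ)
  have hli : LinearIndependent F m := by
    rw [Fintype.linearIndependent_iff]
    rintro g hg ⟨i, j⟩
    have h1 := h.algebraMap_mem_of_sum_mem hz ha.isUnit hb.isUnit ⊥
      (fun x hx r s => by rw [(Submodule.mem_bot F).mp hx]; simp)
      (fun i j => if hij : i < q ∧ j < q then g (⟨i, hij.1⟩, ⟨j, hij.2⟩) else 0) (by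
        rw [Submodule.mem_bot, ← hg, Fintype.sum_prod_type, Finset.sum_range]
        refine Finset.sum_congr rfl fun i _ => ?_
        rw [Finset.sum_range]
        refine Finset.sum_congr rfl fun j _ => ?_
        simp [m]) i.2 j.2
    simpa using h1
  have hspan : Submodule.span F (Set.range m) = ⊤ := by
    refine eq_top_iff.mpr fun x _ => ?_
    obtain ⟨c, rfl⟩ := h.exists_eq_sum hq (x := x) (htop ▸ Algebra.mem_top)
    refine Submodule.sum_mem _ fun i hi => Submodule.sum_mem _ fun j hj =>
      Submodule.smul_mem _ _ (Submodule.subset_span ?_)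
    exact ⟨(⟨i, by simpa using hi⟩, ⟨j, by simpa using hj⟩), rfl⟩
  rw [← finrank_top F E, ← hspan, finrank_span_eq_card hli]
  simp

/-- A division algebra contains no symbol pair one of whose slots is a `q`-th power. -/
theorem slot_ne_pow {D : Type*} [DivisionRing D] [Algebra F D] {u v : D}
    (hz : (Finset.range q : Set ℕ).Pairwise fun i j => IsUnit (z ^ i - z ^ j))
    (h : IsSymbolPair q z a b u v) (hq : 1 < q) (ha : a ≠ 0) (hb : b ≠ 0) (c : F) :
    a ≠ c ^ q := by
  rintro rfl
  have hc : c ≠ 0 := by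
    rintro rfl
    exact ha (zero_pow (by omega))
  have hbot : ∀ x ∈ (⊥ : Submodule F D), ∀ r s : D, r * x * s ∈ (⊥ : Submodule F D) :=
    fun x hx r s => by rw [(Submodule.mem_bot F).mp hx]; simp
  have hcomm : Commute u (algebraMap F D c) := (Algebra.commutes c u).symm
  -- In `u^q - c^q = (u - c) ∑ uʲ c^(q-1-j)` one factor must vanish. The first would make `u`
  -- central, forcing `z = 1`; the second is a relation among monomials with constant coefficient
  -- `c^(q-1) ≠ 0`.
  have hprod := hcomm.mul_geom_sum₂ q
  rw [h.u_pow, map_pow, sub_self, mul_eq_zero] at hprod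
  rcases hprod with h0 | h0
  · rw [sub_eq_zero] at h0
    have hv : v ≠ 0 := (h.isUnit_right (by omega) hb.isUnit).ne_zero
    have h1 := h.comm
    rw [h0, Algebra.commutes, ← one_smul F (v * _), smul_smul, mul_one, ← sub_eq_zero, ← sub_smul,
      smul_eq_zero] at h1
    rcases h1 with h1 | h1
    · have := hz (x := 0) (by simp; omega) (y := 1) (by simpa) (by simp)
      simp [h1] at this
    · exact mul_ne_zero hv (by simpa) h1
  · have h1 := h.algebraMap_mem_of_sum_mem hz ha.isUnit hb.isUnit ⊥ hbot
      (fun i j => if i = 0 then c ^ (q - 1 - j) else 0) (by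
        rw [Submodule.mem_bot, Finset.sum_eq_single_of_mem 0 (by simp; omega) (by
          intro i _ hi
          simp [hi])]
        rw [← h0]
        refine Finset.sum_congr rfl fun j _ => ?_
        rw [if_pos rfl, pow_zero, one_mul, Algebra.smul_def, Algebra.commutes, map_pow])
      (i := 0) (j := 0) (by omega) (by omega)
    simp [hc] at h1

end IsSymbolPair

/-- For `m` the matrix size and `d = dim D`: an algebra of prime degree is either division or split.
-/
theorem Nat.Prime.eq_one_or_of_sq_mul_eq {q m d : ℕ} (hq : q.Prime) (h : m * m * d = q * q) :
    m = 1 ∨ m = q ∧ d = 1 := by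
  have hm : m ∣ q := by
    rw [← Nat.pow_dvd_pow_iff two_ne_zero, pow_two, pow_two]
    exact ⟨d, h.symm⟩
  rcases (Nat.dvd_prime hq).mp hm with rfl | rfl
  · exact Or.inl rfl
  · exact Or.inr ⟨rfl, Nat.eq_of_mul_eq_mul_left (Nat.mul_pos hq.pos hq.pos) (by omega)⟩

/-- Differences of distinct powers of a primitive root of unity of prime order `q` are units,
if `q` is invertible. -/
theorem IsPrimitiveRoot.isUnit_pow_sub_pow {S : Type*} [CommRing S] [IsDomain S] {q : ℕ} {z : S}
    (hz : IsPrimitiveRoot z q) (hp : q.Prime) (hq : IsUnit (q : S)) :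
    (Finset.range q : Set ℕ).Pairwise fun i j => IsUnit (z ^ i - z ^ j) := by
  have hone : ∀ k, 0 < k → k < q → IsUnit (1 - z ^ k) := by
    intro k h0 hk
    obtain ⟨n, rfl⟩ := Nat.exists_eq_succ_of_ne_zero hp.ne_zero
    -- Each `1 - z ^ k` with `0 < k < q` divides the product of all of them, which equals the unit
    -- `q`.
    have hprod := hz.prod_one_sub_pow_eq_order
    rw [← Nat.cast_succ] at hprod
    have hmem : k - 1 ∈ Finset.range n := Finset.mem_range.mpr (by omega)
    have hdvd := Finset.dvd_prod_of_mem (fun k => 1 - z ^ (k + 1)) hmem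
    rw [hprod, Nat.sub_add_cancel h0] at hdvd
    exact isUnit_of_dvd_unit hdvd hq
  have hzu : IsUnit z := hz.isUnit hp.ne_zero
  have key : ∀ i j, i < j → j < q → IsUnit (z ^ i - z ^ j) := by
    intro i j hij hj
    have : z ^ i - z ^ j = z ^ i * (1 - z ^ (j - i)) := by
      rw [mul_sub, mul_one, ← pow_add, Nat.add_sub_cancel' hij.le]
    rw [this]
    exact (hzu.pow i).mul (hone _ (by omega) (by omega))
  intro i hi j hj hij
  simp only [Finset.coe_range, Set.mem_Iio] at hi hj
  rcases lt_or_gt_of_ne hij with h | h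
  · exact key i j h hj
  · rw [← IsUnit.neg_iff, neg_sub]
    exact key j i h hi

/-! ### Finite algebras over a complete local ring -/

section Adic

/-- A finite module over a noetherian complete local ring is complete. -/
theorem IsAdicComplete.of_finite {O M : Type*} [CommRing O] [IsNoetherianRing O]
    [IsLocalRing O] [IsAdicComplete (IsLocalRing.maximalIdeal O) O] [AddCommGroup M] [Module O M]
    [Module.Finite O M] : IsAdicComplete (IsLocalRing.maximalIdeal O) M := by
  set I := IsLocalRing.maximalIdeal O
  refine AdicCompletion.of_bijective_iff.mp ⟨AdicCompletion.of_injective I M, fun x => ?_⟩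
  -- The completion of `M` is a quotient of the completion of `O` tensored with `M`, and `O` is its
  -- own completion.
  obtain ⟨t, rfl⟩ := AdicCompletion.ofTensorProduct_surjective_of_finite I M x
  induction t using TensorProduct.induction_on with
  | zero => exact ⟨0, by simp⟩
  | tmul r y =>
    obtain ⟨r, rfl⟩ := AdicCompletion.of_surjective I O r
    refine ⟨r • y, ?_⟩
    rw [AdicCompletion.ofTensorProduct_tmul, map_smul]
    ext n
    rw [AdicCompletion.smul_eval]
    rfl
  | add x y hx hy =>
    obtain ⟨x', hx⟩ := hx
    obtain ⟨y', hy⟩ := hy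
    exact ⟨x' + y', by rw [map_add, map_add, hx, hy]⟩

/-- An element of a finite algebra that is a unit modulo the maximal ideal is a unit, if the
algebra is a domain. -/
theorem isUnit_of_mul_sub_one_eq_smul {O Λ : Type*} [CommRing O] [IsLocalRing O] [Ring Λ]
    [Algebra O Λ] [Module.Finite O Λ] [IsDomain Λ] {π : O}
    (hπ : IsLocalRing.maximalIdeal O = Ideal.span {π}) (x y w : Λ)
    (h : x * y - 1 = π • w) : IsUnit x := by
  set N := LinearMap.range (LinearMap.mulLeft O x)
  -- Nakayama: `xΛ + πΛ = Λ`, so `xΛ = Λ`. The right inverse obtained is two-sided because `Λ` is a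
  -- domain.
  have hN : (⊤ : Submodule O Λ) ≤ N := by
    refine Submodule.le_of_le_smul_of_le_jacobson_bot (I := IsLocalRing.maximalIdeal O)
      Module.Finite.fg_top (IsLocalRing.maximalIdeal_le_jacobson _) fun t _ => ?_
    have ht : t = x * (y * t) + π • -(w * t) := by
      have : x * y = 1 + π • w := by rw [← h]; abel
      rw [← mul_assoc, this, add_mul, one_mul, smul_neg, smul_mul_assoc]
      abel
    rw [ht]
    exact Submodule.add_mem_sup ⟨y * t, rfl⟩ (Submodule.smul_mem_smul
      (hπ ▸ Ideal.mem_span_singleton_self π) trivial)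
  obtain ⟨t, ht⟩ := hN (trivial : (1 : Λ) ∈ _)
  rw [LinearMap.mulLeft_apply] at ht
  exact IsUnit.of_mul_eq_one _ ht

variable {O Λ : Type*} [CommRing O] [IsNoetherianRing O] [IsLocalRing O]
  [IsAdicComplete (IsLocalRing.maximalIdeal O) O] [Ring Λ] [Algebra O Λ] [Module.Finite O Λ]
  {π : O} (hπ : IsLocalRing.maximalIdeal O = Ideal.span {π})

include hπ

/-- Idempotents lift modulo the maximal ideal of a complete local base, so a domain has no
nontrivial idempotents modulo the maximal ideal. -/
theorem exists_eq_smul_or_of_sq_sub_self [IsDomain Λ] (htors : ∀ x : Λ, π • x = 0 → x = 0)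
    (x y : Λ) (hxy : x * x - x = π • y) : (∃ w, x = π • w) ∨ ∃ w, x - 1 = π • w := by
  -- The double centralizer of `x` is commutative, so Hensel's lemma applies in it. It contains `y`
  -- as well: whatever commutes with `x` commutes with `π • y`, and `Λ` has no `π`-torsion.
  let Z := Subalgebra.centralizer O ({x} : Set Λ)
  let C := Subalgebra.centralizer O (Z : Set Λ)
  have hxC : x ∈ C := by
    rw [Subalgebra.mem_centralizer_iff]
    intro g hg
    exact ((Subalgebra.mem_centralizer_iff O).mp hg x rfl).symm
  have hCZ : C ≤ Z := by
    intro g hg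
    rw [Subalgebra.mem_centralizer_iff] at hg ⊢
    rintro _ rfl
    exact hg _ (by rw [SetLike.mem_coe, Subalgebra.mem_centralizer_iff]; rintro _ rfl; rfl)
  have hyC : y ∈ C := by
    rw [Subalgebra.mem_centralizer_iff]
    intro g hg
    have hgx : g * x = x * g := ((Subalgebra.mem_centralizer_iff O).mp hg x rfl).symm
    rw [← sub_eq_zero]
    refine htors _ ?_
    rw [smul_sub, ← mul_smul_comm, ← smul_mul_assoc, ← hxy, mul_sub, sub_mul, mul_assoc, ← hgx,
      ← mul_assoc, ← mul_assoc, hgx, sub_self]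
  let _ : CommRing C :=
    { (inferInstance : Ring C) with
      mul_comm := fun s t => Subtype.ext
        ((Subalgebra.mem_centralizer_iff O).mp t.2 _ (hCZ s.2)) }
  have hfin : Module.Finite O C := Module.Finite.of_injective C.val.toLinearMap
    Subtype.val_injective
  have hcomp : IsAdicComplete (IsLocalRing.maximalIdeal O) C := IsAdicComplete.of_finite
  have hcomp' : IsAdicComplete ((IsLocalRing.maximalIdeal O).map (algebraMap O C)) C :=
    (IsAdicComplete.map_algebraMap_iff _ _).mpr hcomp
  set J := (IsLocalRing.maximalIdeal O).map (algebraMap O C) with hJ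
  have hJmem : ∀ t : C, t ∈ J ↔ ∃ s : C, t = π • s := by
    intro t
    rw [hJ, hπ, Ideal.map_span, Set.image_singleton, Ideal.mem_span_singleton]
    simp only [dvd_def, Algebra.smul_def]
  let X : C := ⟨x, hxC⟩
  have hXJ : X * X - X ∈ J := (hJmem _).mpr ⟨⟨y, hyC⟩, Subtype.ext hxy⟩
  -- The derivative `2X - 1` is its own inverse modulo `J`, since `(2X - 1)² - 1 = 4(X² - X)`.
  obtain ⟨e, he, hex⟩ := HenselianRing.is_henselian (I := J)
    (Polynomial.X ^ 2 - Polynomial.X : Polynomial C) (by monicity!) X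
    (by simpa [pow_two] using hXJ) (by
      refine IsUnit.of_mul_eq_one (Ideal.Quotient.mk J (2 * X - 1)) ?_
      rw [← map_mul, ← map_one (Ideal.Quotient.mk J), Ideal.Quotient.eq]
      simp only [Polynomial.derivative_sub, Polynomial.derivative_X_pow, Polynomial.derivative_X,
        Polynomial.eval_sub, Polynomial.eval_mul, Polynomial.eval_pow, Polynomial.eval_X,
        Polynomial.eval_one, Polynomial.eval_C]
      have : ((2 : ℕ) : C) * X ^ (2 - 1) - 1 = 2 * X - 1 := by push_cast; ring
      rw [this]
      have : (2 * X - 1) * (2 * X - 1) - 1 = 4 * (X * X - X) := by ring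
      rw [this]
      exact J.mul_mem_left _ hXJ)
  rw [Polynomial.IsRoot, Polynomial.eval_sub, Polynomial.eval_pow, Polynomial.eval_X] at he
  obtain ⟨s, hs⟩ := (hJmem _).mp hex
  have he' : (e : Λ) * ((e : Λ) - 1) = 0 := by
    have := congrArg (Subtype.val) he
    simpa [pow_two, mul_sub] using this
  have hs' : (e : Λ) - x = π • (s : Λ) := congrArg Subtype.val hs
  rcases mul_eq_zero.mp he' with h0 | h0
  · exact Or.inl ⟨-s, by rw [smul_neg, ← hs', h0, zero_sub, neg_neg]⟩
  · refine Or.inr ⟨-s, ?_⟩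
    rw [smul_neg, ← hs', sub_eq_zero.mp h0, neg_sub]

/-- If `Λ / πΛ` is simple and `Λ` is a domain, finite over a complete discrete valuation ring
with uniformizer `π`, then every element of `Λ` outside `πΛ` is a unit. -/
theorem eq_smul_or_isUnit [IsDomain Λ] (htors : ∀ x : Λ, π • x = 0 → x = 0)
    (hsimple : ∀ N : Submodule O Λ, (∀ x ∈ N, ∀ r s : Λ, r * x * s ∈ N) → (∀ x, π • x ∈ N) →
      (∀ x ∈ N, ∃ w, x = π • w) ∨ N = ⊤) (x : Λ) : (∃ w, x = π • w) ∨ IsUnit x := by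
  let I : Ideal Λ :=
    { carrier := {t | ∃ w, t = π • w}
      zero_mem' := ⟨0, by simp⟩
      add_mem' := by
        rintro _ _ ⟨s, rfl⟩ ⟨t, rfl⟩
        exact ⟨s + t, by rw [smul_add]⟩
      smul_mem' := by
        rintro c _ ⟨s, rfl⟩
        exact ⟨c * s, by rw [smul_eq_mul, mul_smul_comm]⟩ }
  have hI : ∀ t, t ∈ I ↔ ∃ w, t = π • w := fun t => Iff.rfl
  have hI2 : I.IsTwoSided := ⟨by
    rintro _ c ⟨s, rfl⟩
    exact ⟨s * c, by rw [smul_mul_assoc]⟩⟩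
  by_cases hx : x ∈ I
  · exact Or.inl hx
  right
  have hnt : Nontrivial (Λ ⧸ I) := Ideal.Quotient.nontrivial_iff.mpr (by
    rintro h
    exact hx (h ▸ trivial))
  have hsimp : IsSimpleRing (Λ ⧸ I) := ⟨{
    eq_bot_or_eq_top := fun T => by
      let N : Submodule O Λ :=
        { carrier := {t | Ideal.Quotient.mk I t ∈ T}
          zero_mem' := by simp [T.zero_mem]
          add_mem' := fun hs ht => by
            simp only [Set.mem_ofPred_eq, map_add] at hs ht ⊢
            exact T.add_mem hs ht
          smul_mem' := fun c s hs => by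
            simp only [Set.mem_ofPred_eq, Algebra.smul_def, map_mul] at hs ⊢
            exact T.mul_mem_left _ _ hs }
      have hN : ∀ t, t ∈ N ↔ Ideal.Quotient.mk I t ∈ T := fun t => Iff.rfl
      rcases hsimple N
        (fun t ht r s => by
          rw [hN] at ht ⊢
          rw [map_mul, map_mul]
          exact T.mul_mem_right _ _ (T.mul_mem_left _ _ ht))
        (fun t => by
          rw [hN, Ideal.Quotient.eq_zero_iff_mem.mpr ((hI _).mpr ⟨t, rfl⟩)]
          exact T.zero_mem) with h | h
      · left
        refine eq_bot_iff.mpr fun t ht => ?_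
        obtain ⟨t, rfl⟩ := Ideal.Quotient.mk_surjective t
        rw [TwoSidedIdeal.mem_bot]
        exact Ideal.Quotient.eq_zero_iff_mem.mpr ((hI _).mpr (h t ((hN t).mpr ht)))
      · right
        refine eq_top_iff.mpr fun t _ => ?_
        obtain ⟨t, rfl⟩ := Ideal.Quotient.mk_surjective t
        exact (hN t).mp (h ▸ trivial) }⟩
  -- The quotient is a finite module over the residue field, hence artinian, and Wedderburn's
  -- theorem makes it a matrix ring.
  have htorsion : Module.IsTorsionBySet O (Λ ⧸ I) (IsLocalRing.maximalIdeal O) := by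
    rintro t ⟨c, hc⟩
    obtain ⟨t, rfl⟩ := Ideal.Quotient.mk_surjective t
    rw [SetLike.mem_coe, hπ, Ideal.mem_span_singleton] at hc
    obtain ⟨d, rfl⟩ := hc
    exact Ideal.Quotient.eq_zero_iff_mem.mpr ((hI _).mpr ⟨d • t, by rw [smul_smul]⟩)
  have hfin : Module.Finite O (Λ ⧸ I) := Module.Finite.of_surjective
    (Ideal.Quotient.mkₐ O I).toLinearMap Ideal.Quotient.mk_surjective
  let _ := htorsion.module
  let _ : Field (O ⧸ IsLocalRing.maximalIdeal O) := Ideal.Quotient.field _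
  have hss : IsSemisimpleModule O (Λ ⧸ I) := htorsion.isSemisimpleModule_iff.mp inferInstance
  have hart : IsArtinian O (Λ ⧸ I) := inferInstance
  have hart' : IsArtinianRing (Λ ⧸ I) := isArtinian_of_tower O hart
  obtain ⟨n, hn, D, _, ⟨e⟩⟩ := IsSimpleRing.exists_ringEquiv_matrix_divisionRing (Λ ⧸ I)
  -- A diagonal matrix unit with index `i ≠ 0` would be an idempotent of the quotient other than `0`
  -- and `1`.
  have hn1 : ∀ i : Fin n, i = 0 := by
    intro i
    by_contra hi
    obtain ⟨p, hp⟩ := Ideal.Quotient.mk_surjective (e.symm (Matrix.single i i 1))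
    have hpp : p * p - p ∈ I := by
      rw [← Ideal.Quotient.eq, map_mul, hp, ← map_mul]
      simp
    obtain ⟨y, hy⟩ := hpp
    rcases exists_eq_smul_or_of_sq_sub_self hπ htors p y hy with h | h
    · have h1 := Ideal.Quotient.eq_zero_iff_mem.mpr ((hI p).mpr h)
      rw [hp, map_eq_zero_iff e.symm e.symm.injective] at h1
      simpa using congrFun (congrFun h1 i) i
    · have h1 := Ideal.Quotient.eq.mpr ((hI _).mpr h)
      rw [hp, map_one, map_eq_one_iff e.symm e.symm.injective] at h1
      have h2 := congrFun (congrFun h1 0) 0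
      rw [Matrix.single_apply_of_ne _ _ _ _ _ (fun h => hi h.1), Matrix.one_apply_eq] at h2
      exact zero_ne_one h2
  have hx0 : e (Ideal.Quotient.mk I x) 0 0 ≠ 0 := by
    intro h
    refine hx (Ideal.Quotient.eq_zero_iff_mem.mp ((map_eq_zero_iff e e.injective).mp ?_))
    ext i j
    rw [hn1 i, hn1 j, h, Matrix.zero_apply]
  obtain ⟨y, hy⟩ := Ideal.Quotient.mk_surjective
    (e.symm (Matrix.of fun _ _ => (e (Ideal.Quotient.mk I x) 0 0)⁻¹))
  have hxy : x * y - 1 ∈ I := by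
    rw [← Ideal.Quotient.eq, map_mul, hy, map_one]
    apply e.injective
    rw [map_mul, e.apply_symm_apply, map_one]
    ext i j
    have huniv : (Finset.univ : Finset (Fin n)) = {0} := by
      ext k
      simp [hn1 k]
    rw [hn1 i, hn1 j, Matrix.mul_apply, huniv, Finset.sum_singleton, Matrix.of_apply,
      mul_inv_cancel₀ hx0, Matrix.one_apply_eq]
  obtain ⟨w, hw⟩ := hxy
  exact isUnit_of_mul_sub_one_eq_smul hπ x y w hw

end Adic

-- Powers of the maximal ideal are valuation balls, so an adically Cauchy sequence converges in the
-- complete field. Balls are closed, so the limit inherits the congruences and is integral.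
open IsDedekindDomain HeightOneSpectrum in
instance isAdicComplete_adicCompletionIntegers {A : Type*} [CommRing A] [IsDedekindDomain A]
    (K : Type*) [Field K] [Algebra A K] [IsFractionRing A K] (ν : HeightOneSpectrum A) :
    IsAdicComplete (IsLocalRing.maximalIdeal (ν.adicCompletionIntegers K))
      (ν.adicCompletionIntegers K) where
  prec' f hf := by
    obtain ⟨ϖ, hϖ⟩ := IsDiscreteValuationRing.exists_irreducible (ν.adicCompletionIntegers K)
    have hint := adicCompletionIntegers.integers K ν
    have hmem : ∀ (n : ℕ) (x : ν.adicCompletionIntegers K),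
        x ∈ IsLocalRing.maximalIdeal (ν.adicCompletionIntegers K) ^ n ↔
          Valued.v.restrict (x : ν.adicCompletion K) ≤
            Valued.v.restrict ((ϖ : ν.adicCompletion K) ^ n) := by
      intro n x
      rw [hϖ.maximalIdeal_eq, Ideal.span_singleton_pow, Ideal.mem_span_singleton,
        hint.dvd_iff_le, Valuation.restrict_le_iff]
      simp
    have hsub : ∀ m n, m ≤ n →
        Valued.v.restrict ((f n : ν.adicCompletion K) - f m) ≤
            Valued.v.restrict ((ϖ : ν.adicCompletion K) ^ m) := by
      intro m n hmn
      have h := SModEq.sub_mem.mp (hf hmn).symm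
      rw [smul_eq_mul, Ideal.mul_top, hmem] at h
      exact h
    have hϖ1 : Valued.v (ϖ : ν.adicCompletion K) < 1 := by
      refine lt_of_le_of_ne ϖ.2 fun h => hϖ.not_isUnit ?_
      exact adicCompletionIntegers.isUnit_iff_valued_eq_one.mpr h
    have hcauchy : CauchySeq fun n => (f n : ν.adicCompletion K) := by
      refine Valued.cauchy_iff.mpr ⟨inferInstance, fun γ => ?_⟩
      obtain ⟨n, hn⟩ := exists_pow_lt₀ hϖ1
        (Units.mk0 (MonoidWithZeroHom.ValueGroup₀.embedding γ.1) (by simp))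
      have hn' : Valued.v.restrict ((ϖ : ν.adicCompletion K) ^ n) < γ.1 := by
        rw [← MonoidWithZeroHom.ValueGroup₀.embedding_strictMono.lt_iff_lt,
          Valuation.embedding_restrict, map_pow]
        exact hn
      refine ⟨_, Filter.image_mem_map (Filter.Ici_mem_atTop n), ?_⟩
      rintro _ ⟨k, hk, rfl⟩ _ ⟨l, hl, rfl⟩
      refine lt_of_le_of_lt ?_ hn'
      have : (f l : ν.adicCompletion K) - f k = (f l - f n) - (f k - f n) := by ring
      rw [this]
      exact (Valuation.map_sub _ _ _).trans (max_le (hsub n l hl) (hsub n k hk))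
    obtain ⟨L, hL⟩ := cauchySeq_tendsto_of_complete hcauchy
    have hLn : ∀ n, Valued.v.restrict (L - f n) ≤
        Valued.v.restrict ((ϖ : ν.adicCompletion K) ^ n) := by
      intro n
      refine (Valued.isClosed_closedBall (ν.adicCompletion K) _).mem_of_tendsto
        (hL.sub_const (f n : ν.adicCompletion K)) ?_
      filter_upwards [Filter.Ici_mem_atTop n] with k hk using hsub n k hk
    have hLint : L ∈ ν.adicCompletionIntegers K := by
      have h0 : L - f 0 ∈ ν.adicCompletionIntegers K := by
        have := hLn 0
        rw [Valuation.restrict_le_iff, pow_zero, map_one] at this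
        exact this
      simpa using add_mem h0 (f 0).2
    refine ⟨⟨L, hLint⟩, fun n => ?_⟩
    symm
    rw [SModEq.sub_mem, smul_eq_mul, Ideal.mul_top, hmem]
    exact hLn n

/-- Multiply a monic equation of degree `n + 1` for `x` by `x⁻¹ ^ n`. Consequently a subalgebra
containing `x⁻¹` contains the integral element `x`. -/
theorem IsIntegral.mem_adjoin_inv_of_divisionRing {O D : Type*} [CommRing O] [DivisionRing D]
    [Algebra O D] {x : D} (hx : IsIntegral O x) : x ∈ Algebra.adjoin O {x⁻¹} := by
  rcases eq_or_ne x 0 with rfl | h0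
  · exact zero_mem _
  obtain ⟨p, hp, hpx⟩ := hx
  have hpx' : Polynomial.aeval x p = 0 := hpx
  rw [Polynomial.aeval_eq_sum_range, Finset.sum_range_succ, hp.coeff_natDegree, one_smul] at hpx'
  obtain ⟨n, hn⟩ : ∃ n, p.natDegree = n + 1 := Nat.exists_eq_succ_of_ne_zero (by
    intro h
    simp [h] at hpx')
  rw [hn] at hpx'
  replace hpx' := eq_neg_of_add_eq_zero_right hpx'
  have hxn : x = x ^ (n + 1) * x⁻¹ ^ n := by
    rw [pow_succ', mul_assoc, ← (Commute.refl x).inv_right₀.mul_pow, mul_inv_cancel₀ h0, one_pow,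
      mul_one]
  refine (congrArg (· ∈ Algebra.adjoin O {x⁻¹}) hxn).mpr ?_
  rw [hpx', neg_mul, Finset.sum_mul]
  refine neg_mem (Subalgebra.sum_mem _ fun i hi => ?_)
  have hle : i ≤ n := by simpa [Nat.lt_succ_iff] using hi
  have hi' : x ^ i * x⁻¹ ^ n = x⁻¹ ^ (n - i) := by
    rw [← Nat.add_sub_cancel' hle, pow_add, ← mul_assoc, ← (Commute.refl x).inv_right₀.mul_pow,
      mul_inv_cancel₀ h0, one_pow, one_mul, Nat.add_sub_cancel_left]
  rw [smul_mul_assoc, hi']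
  exact Subalgebra.smul_mem _ (pow_mem (Algebra.self_mem_adjoin_singleton O x⁻¹) _) _

/-! ### Algebras generated by a symbol pair with unit slots -/

namespace IsSymbolPair

/-- This is simplicity of `Λ/πΛ`: a two-sided ideal contains the coefficients of its elements as
scalars, so either it contains a unit or all these coefficients are divisible by `π`. -/
theorem forall_eq_smul_or_eq_top {O Λ : Type*} [CommRing O] [IsLocalRing O] [Ring Λ] [Algebra O Λ]
    {π : O} (hπ : IsLocalRing.maximalIdeal O = Ideal.span {π}) {q : ℕ} {z a b : O} {u v : Λ}
    (hz : (Finset.range q : Set ℕ).Pairwise fun i j => IsUnit (z ^ i - z ^ j))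
    (h : IsSymbolPair q z a b u v) (hq : q ≠ 0) (ha : IsUnit a) (hb : IsUnit b)
    (htop : Algebra.adjoin O {u, v} = ⊤) (N : Submodule O Λ)
    (hN : ∀ x ∈ N, ∀ r s : Λ, r * x * s ∈ N) : (∀ x ∈ N, ∃ w, x = π • w) ∨ N = ⊤ := by
  by_cases hunit : ∃ c, IsUnit c ∧ algebraMap O Λ c ∈ N
  · right
    obtain ⟨c, ⟨c, rfl⟩, hc⟩ := hunit
    refine eq_top_iff.mpr fun t _ => ?_
    have h1 := N.smul_mem (↑c⁻¹ : O) hc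
    rw [Algebra.smul_def, ← map_mul, Units.inv_mul, map_one] at h1
    simpa using hN _ h1 1 t
  · left
    push Not at hunit
    intro x hx
    obtain ⟨c, rfl⟩ := h.exists_eq_sum hq (x := x) (htop ▸ Algebra.mem_top)
    have hc : ∀ i < q, ∀ j < q, ∃ d, c i j = π * d := by
      intro i hi j hj
      rw [← dvd_def, ← Ideal.mem_span_singleton, ← hπ, IsLocalRing.mem_maximalIdeal]
      exact fun hu => hunit _ hu (h.algebraMap_mem_of_sum_mem hz ha hb N hN c hx hi hj)
    choose! d hd using hc
    refine ⟨∑ i ∈ Finset.range q, ∑ j ∈ Finset.range q, d i j • (v ^ i * u ^ j), ?_⟩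
    simp only [Finset.smul_sum]
    refine Finset.sum_congr rfl fun i hi => Finset.sum_congr rfl fun j hj => ?_
    rw [smul_smul, ← hd i (by simpa using hi) j (by simpa using hj)]

end IsSymbolPair

/-- The symbol relations pass to `A / rad A`, and an algebra generated by such a pair is central
over `O`; the radical need not be computed. -/
theorem residueExtension_eq_bot_of_adjoin_eq_top {O D : Type*} [CommRing O] [Ring D]
    [Algebra O D] {q : ℕ} {z a b : O} {A : Subalgebra O D}
    {u v : A}
    (hz : (Finset.range q : Set ℕ).Pairwise fun i j => IsUnit (z ^ i - z ^ j))
    (h : IsSymbolPair q z a b u v) (hq : q ≠ 0) (ha : IsUnit a) (hb : IsUnit b)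
    (htop : Algebra.adjoin O {u, v} = ⊤) : residueExtension O A = ⊥ := by
  refine (h.map (Ideal.Quotient.mkₐ O (Ring.jacobson A))).center_eq_bot hz hq ha hb ?_
  rw [← Set.image_pair, ← AlgHom.map_adjoin, htop, Algebra.map_top, AlgHom.range_eq_top]
  exact Ideal.Quotient.mk_surjective

/-! ### Maximal orders and residue extensions over a discrete valuation ring -/

section Residue

variable {O : Type*} {F D : Type v} [CommRing O] [IsDomain O] [IsDiscreteValuationRing O] [Field F]
  [Algebra O F] [IsFractionRing O F] [DivisionRing D] [Algebra F D] [Algebra O D]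
  [IsScalarTower O F D]

-- Here `D = F`, and elements of an order are integral over the integrally closed ring `O`, so the
-- order consists of scalars.
include F in
theorem residueExtension_eq_bot_of_finrank_eq_one (hD : Module.finrank F D = 1)
    {A : Subalgebra O D} (hA : IsOrderIn O F A) : residueExtension O A = ⊥ := by
  refine eq_bot_iff.mpr fun x _ => ?_
  obtain ⟨x, rfl⟩ := Ideal.Quotient.mk_surjective x
  have hfin := hA.finite
  have hint : IsIntegral O (x : D) := (IsIntegral.of_finite O x).map A.val
  obtain ⟨f, hf⟩ := (finrank_eq_one_iff_of_nonzero' (1 : D) one_ne_zero).mp hD x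
  rw [← Algebra.algebraMap_eq_smul_one] at hf
  rw [← hf] at hint
  replace hint := (isIntegral_algHom_iff (IsScalarTower.toAlgHom O F D)
    (algebraMap F D).injective (x := f)).mp hint
  obtain ⟨r, rfl⟩ := IsIntegrallyClosed.isIntegral_iff.mp hint
  refine Algebra.mem_bot.mpr ⟨r, ?_⟩
  have : x = algebraMap O A r := Subtype.ext (by
    rw [← hf, ← IsScalarTower.algebraMap_apply]
    rfl)
  rw [this]
  rfl

variable [IsAdicComplete (IsLocalRing.maximalIdeal O) O]

include F in
/-- In a division algebra over a complete discretely valued field that is generated by a symbol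
pair with unit slots, the order generated by the pair is the only maximal order. -/
theorem IsSymbolPair.eq_adjoin_of_isMaximalOrderIn {q : ℕ} {z a b : O} {u v : D}
    (hz : (Finset.range q : Set ℕ).Pairwise fun i j => IsUnit (z ^ i - z ^ j))
    (h : IsSymbolPair q z a b u v) (hq : q ≠ 0) (ha : IsUnit a) (hb : IsUnit b)
    (htop : Algebra.adjoin F {u, v} = ⊤) {A : Subalgebra O D} (hA : IsMaximalOrderIn O F A) :
    A = Algebra.adjoin O {u, v} := by
  set Λ := Algebra.adjoin O {u, v} with hΛ
  obtain ⟨π, hπ⟩ := IsDiscreteValuationRing.exists_irreducible O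
  have hinj : Function.Injective (algebraMap O D) := by
    rw [IsScalarTower.algebraMap_eq O F D]
    exact (algebraMap F D).injective.comp (IsFractionRing.injective O F)
  have hsmul : ∀ (c : O) (x : D), c ≠ 0 → c • x = 0 → x = 0 := by
    intro c x hc hx
    rw [Algebra.smul_def, mul_eq_zero] at hx
    exact hx.resolve_left fun h => hc (hinj (by rw [h, map_zero]))
  have hfg : Λ.toSubmodule.FG := by
    have hle : Λ.toSubmodule ≤ Submodule.span O
        (Set.range fun p : Fin q × Fin q => v ^ (p.1 : ℕ) * u ^ (p.2 : ℕ)) := by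
      intro x hx
      obtain ⟨c, rfl⟩ := h.exists_eq_sum hq hx
      exact Submodule.sum_mem _ fun i hi => Submodule.sum_mem _ fun j hj =>
        Submodule.smul_mem _ _ (Submodule.subset_span
          ⟨(⟨i, by simpa using hi⟩, ⟨j, by simpa using hj⟩), rfl⟩)
    exact Submodule.FG.of_le (Submodule.fg_span (Set.finite_range _)) hle
  have hfin : Module.Finite O Λ := Module.Finite.iff_fg.mpr hfg
  have hu : u ∈ Λ := Algebra.subset_adjoin (by simp)
  have hv : v ∈ Λ := Algebra.subset_adjoin (by simp)
  have hpair : IsSymbolPair q z a b (⟨u, hu⟩ : Λ) (⟨v, hv⟩ : Λ) :=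
    ⟨Subtype.ext h.u_pow, Subtype.ext h.v_pow, Subtype.ext h.comm⟩
  have hΛtop : Algebra.adjoin O {(⟨u, hu⟩ : Λ), (⟨v, hv⟩ : Λ)} = ⊤ := by
    have := Algebra.adjoin_adjoin_coe_preimage (R := O) (s := {u, v})
    convert this using 2
    ext t
    simp [Subtype.ext_iff]
  have hdich := eq_smul_or_isUnit (Λ := Λ) hπ.maximalIdeal_eq
    (fun x hx => Subtype.ext (hsmul π x hπ.ne_zero (congrArg Subtype.val hx)))
    (fun N hN _ => hpair.forall_eq_smul_or_eq_top hπ.maximalIdeal_eq hz hq ha hb hΛtop N hN)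
  have hden : ∀ x : D, ∃ d : O, d ≠ 0 ∧ d • x ∈ Λ := by
    intro x
    have hx : x ∈ Algebra.adjoin F {u, v} := htop ▸ Algebra.mem_top
    induction hx using Algebra.adjoin_induction with
    | mem x hx => exact ⟨1, one_ne_zero, by rw [one_smul]; exact Algebra.subset_adjoin hx⟩
    | algebraMap r =>
      obtain ⟨s, t, ht, rfl⟩ := IsFractionRing.div_surjective (A := O) r
      have ht0 := nonZeroDivisors.ne_zero ht
      refine ⟨t, ht0, ?_⟩
      have : t • algebraMap F D (algebraMap O F s / algebraMap O F t) = algebraMap O D s := by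
        rw [Algebra.smul_def, IsScalarTower.algebraMap_apply O F D t, ← map_mul,
          mul_div_cancel₀, ← IsScalarTower.algebraMap_apply]
        exact (map_ne_zero_iff _ (IsFractionRing.injective O F)).mpr ht0
      rw [this]
      exact Λ.algebraMap_mem s
    | add x y _ _ hx hy =>
      obtain ⟨c, hc, hx⟩ := hx
      obtain ⟨d, hd, hy⟩ := hy
      refine ⟨c * d, mul_ne_zero hc hd, ?_⟩
      rw [smul_add, mul_comm, mul_smul, mul_comm, mul_smul]
      exact add_mem (Λ.smul_mem hx d) (Λ.smul_mem hy c)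
    | mul x y _ _ hx hy =>
      obtain ⟨c, hc, hx⟩ := hx
      obtain ⟨d, hd, hy⟩ := hy
      refine ⟨c * d, mul_ne_zero hc hd, ?_⟩
      rw [← smul_mul_smul_comm]
      exact mul_mem hx hy
  have hspan : Submodule.span F (Λ : Set D) = ⊤ := by
    refine eq_top_iff.mpr fun x _ => ?_
    obtain ⟨d, hd, hx⟩ := hden x
    have hd' : algebraMap O F d ≠ 0 :=
      (map_ne_zero_iff _ (IsFractionRing.injective O F)).mpr hd
    have h1 := Submodule.smul_mem _ (algebraMap O F d)⁻¹
      (Submodule.subset_span (R := F) (s := (Λ : Set D)) hx)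
    rwa [← algebraMap_smul F d x, smul_smul, inv_mul_cancel₀ hd', one_smul] at h1
  -- `Λ` is itself an order, so by maximality of `A` only `A ≤ Λ` is needed.
  refine hA.eq_of_le ⟨hfin, hspan⟩ fun x hxA => ?_
  have hAfin := hA.prop.finite
  have hint : IsIntegral O x := (IsIntegral.of_finite O (⟨x, hxA⟩ : A)).map A.val
  by_contra hxΛ
  have hex : ∃ n : ℕ, π ^ n • x ∈ Λ := by
    obtain ⟨d, hd, hx⟩ := hden x
    obtain ⟨n, c, hc⟩ := IsDiscreteValuationRing.associated_pow_irreducible hd hπ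
    refine ⟨n, ?_⟩
    rw [← hc, mul_comm, mul_smul]
    exact Λ.smul_mem hx _
  classical
  -- With the exponent minimal, `π ^ (n + 1) • x` lies outside `πΛ` and is a unit of `Λ`. Then `x⁻¹
  -- ∈ Λ`, and integrality brings `x` back into `Λ`.
  obtain ⟨n, hn⟩ : ∃ n, Nat.find hex = n + 1 := Nat.exists_eq_succ_of_ne_zero (by
    intro h0
    have := Nat.find_spec hex
    rw [h0, pow_zero, one_smul] at this
    exact hxΛ this)
  have hmem := Nat.find_spec hex
  rw [hn] at hmem
  rcases hdich ⟨_, hmem⟩ with ⟨w, hw⟩ | hunit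
  · have hw' : π ^ (n + 1) • x = π • (w : D) := congrArg Subtype.val hw
    refine Nat.find_min hex (m := n) (by omega) ?_
    rw [pow_succ', mul_smul, ← sub_eq_zero, ← smul_sub] at hw'
    rw [sub_eq_zero.mp (hsmul π _ hπ.ne_zero hw')]
    exact w.2
  · obtain ⟨y, hy⟩ := hunit.exists_right_inv
    have hy' : (π ^ (n + 1) • x) * (y : D) = 1 := congrArg Subtype.val hy
    rw [smul_mul_assoc, ← mul_smul_comm] at hy'
    have hxinv : x⁻¹ ∈ Λ := by
      rw [inv_eq_of_mul_eq_one_right hy']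
      exact Λ.smul_mem y.2 _
    exact hxΛ (Algebra.adjoin_le (Set.singleton_subset_iff.mpr hxinv)
      hint.mem_adjoin_inv_of_divisionRing)

/-- The residue extension of a symbol algebra of prime degree over a complete discretely valued
field is trivial if the first slot is a unit and a `q`-th power modulo the second slot. -/
theorem residueExtension_eq_bot_of_isSymbolPair {E : Type*} [Ring E] [Algebra F E] {q : ℕ}
    (hp : q.Prime) (hq : IsUnit (q : O)) {z a b : O} (hz : IsPrimitiveRoot z q) (ha : IsUnit a)
    (hb : b ≠ 0) (hab : ∃ c, b ∣ a - c ^ q) {u v : E}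
    (h : IsSymbolPair q (algebraMap O F z) (algebraMap O F a) (algebraMap O F b) u v)
    (htop : Algebra.adjoin F {u, v} = ⊤) (hD : IsDivisionComponent F E D)
    {A : Subalgebra O D} (hA : IsMaximalOrderIn O F A) : residueExtension O A = ⊥ := by
  obtain ⟨m, hm, ⟨e⟩⟩ := hD
  have hm' : Nonempty (Fin m) := ⟨⟨0, Nat.pos_of_ne_zero hm⟩⟩
  have hE : Nontrivial E := e.toEquiv.nontrivial
  have hinj := IsFractionRing.injective O F
  have hzO := hz.isUnit_pow_sub_pow hp hq
  have hzF : (Finset.range q : Set ℕ).Pairwise fun i j =>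
      IsUnit (algebraMap O F z ^ i - algebraMap O F z ^ j) := fun i hi j hj hij => by
    simpa only [map_sub, map_pow] using (hzO hi hj hij).map (algebraMap O F)
  have haF : algebraMap O F a ≠ 0 := (map_ne_zero_iff _ hinj).mpr ha.ne_zero
  have hbF : algebraMap O F b ≠ 0 := (map_ne_zero_iff _ hinj).mpr hb
  have hrank := h.finrank_eq hzF hp.ne_zero haF hbF htop
  rw [e.toLinearEquiv.finrank_eq, Module.finrank_matrix, Fintype.card_fin] at hrank
  rcases hp.eq_one_or_of_sq_mul_eq hrank with rfl | ⟨-, hd⟩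
  · obtain ⟨e₁⟩ : Nonempty (Matrix (Fin 1) (Fin 1) D ≃ₐ[F] D) := by
      convert Nonempty.intro (Matrix.uniqueAlgEquiv (m := Fin 1) (A := D) (R := F))
    let e' : E ≃ₐ[F] D := e.trans e₁
    have hF := h.map e'.toAlgHom
    -- If `b` is not a unit, then `a ≡ c^q` modulo the maximal ideal with `c` a unit. Hensel's lemma
    -- makes `a` a `q`-th power, which is impossible in a division algebra.
    have hb' : IsUnit b := by
      by_contra hbu
      obtain ⟨c, hc⟩ := hab
      have hmem : c ^ q - a ∈ IsLocalRing.maximalIdeal O := by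
        rw [← neg_sub]
        exact neg_mem (Ideal.mem_of_dvd _ hc ((IsLocalRing.mem_maximalIdeal b).mpr hbu))
      have hcu : IsUnit c := by
        rw [← isUnit_pow_iff hp.ne_zero]
        by_contra hcu
        refine (IsLocalRing.mem_maximalIdeal a).mp ?_ ha
        rw [← sub_sub_cancel (c ^ q) a]
        exact sub_mem hcu hmem
      obtain ⟨r, hr, -⟩ := HenselianRing.is_henselian (I := IsLocalRing.maximalIdeal O)
        (Polynomial.X ^ q - Polynomial.C a : Polynomial O)
        (Polynomial.monic_X_pow_sub_C a hp.ne_zero) c (by simpa using hmem) (by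
          refine IsUnit.map _ ?_
          rw [Polynomial.derivative_sub, Polynomial.derivative_X_pow, Polynomial.derivative_C,
            sub_zero, Polynomial.eval_mul, Polynomial.eval_C, Polynomial.eval_pow,
            Polynomial.eval_X]
          exact hq.mul (hcu.pow (q - 1)))
      rw [Polynomial.IsRoot, Polynomial.eval_sub, Polynomial.eval_pow, Polynomial.eval_X,
        Polynomial.eval_C, sub_eq_zero] at hr
      refine hF.slot_ne_pow hzF hp.one_lt haF hbF (algebraMap O F r) ?_
      rw [← map_pow, hr]
    have hO : IsSymbolPair q z a b (e' u) (e' v) :=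
      ⟨by rw [IsScalarTower.algebraMap_apply O F D]; exact hF.u_pow,
        by rw [IsScalarTower.algebraMap_apply O F D]; exact hF.v_pow,
        by rw [← algebraMap_smul F z]; exact hF.comm⟩
    have htop' : Algebra.adjoin F {e' u, e' v} = ⊤ := by
      have := congrArg (Subalgebra.map e'.toAlgHom) htop
      rw [AlgHom.map_adjoin, Set.image_pair, Algebra.map_top,
        (AlgHom.range_eq_top _).mpr e'.surjective] at this
      exact this
    obtain rfl := hO.eq_adjoin_of_isMaximalOrderIn (F := F) hzO hp.ne_zero ha hb' htop' hA
    have hu : e' u ∈ Algebra.adjoin O {e' u, e' v} := Algebra.subset_adjoin (by simp)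
    have hv : e' v ∈ Algebra.adjoin O {e' u, e' v} := Algebra.subset_adjoin (by simp)
    refine residueExtension_eq_bot_of_adjoin_eq_top (u := ⟨_, hu⟩) (v := ⟨_, hv⟩) hzO
      ⟨Subtype.ext hO.u_pow, Subtype.ext hO.v_pow, Subtype.ext hO.comm⟩ hp.ne_zero ha hb' ?_
    have := Algebra.adjoin_adjoin_coe_preimage (R := O) (s := {e' u, e' v})
    convert this using 2
    ext t
    simp [Subtype.ext_iff]
  · exact residueExtension_eq_bot_of_finrank_eq_one hd hA.prop

end Residue

/-! ### The symbol algebra and its scalar extensions -/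

section SymbolAlgebra

variable (K : Type*) [Field K] (n : ℕ) (ζ a b : K)

/-- The canonical generators of the symbol algebra. -/
noncomputable def SymbolAlgebra.gen (i : Fin 2) : SymbolAlgebra K n ζ a b :=
  RingQuot.mkAlgHom K (SymbolRel K n ζ a b) (FreeAlgebra.ι K i)

theorem SymbolAlgebra.isSymbolPair_gen :
    IsSymbolPair n ζ a b (gen K n ζ a b 0) (gen K n ζ a b 1) where
  u_pow := by
    rw [gen, ← map_pow, RingQuot.mkAlgHom_rel K SymbolRel.u_pow, AlgHom.commutes]
  v_pow := by
    rw [gen, ← map_pow, RingQuot.mkAlgHom_rel K SymbolRel.v_pow, AlgHom.commutes]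
  comm := by
    rw [gen, gen, ← map_mul, RingQuot.mkAlgHom_rel K SymbolRel.comm, map_smul, map_mul]

theorem SymbolAlgebra.adjoin_gen :
    Algebra.adjoin K {gen K n ζ a b 0, gen K n ζ a b 1} = ⊤ := by
  have h : ({gen K n ζ a b 0, gen K n ζ a b 1} : Set (SymbolAlgebra K n ζ a b)) =
      RingQuot.mkAlgHom K (SymbolRel K n ζ a b) '' Set.range (FreeAlgebra.ι K) := by
    rw [← Set.range_comp]
    ext t
    simp [gen, Fin.exists_fin_two, eq_comm]
  rw [h, ← AlgHom.map_adjoin, FreeAlgebra.adjoin_range_ι, Algebra.map_top, AlgHom.range_eq_top]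
  exact RingQuot.mkAlgHom_surjective K _

end SymbolAlgebra

section BaseChange

variable {K F B : Type*} [Field K] [Field F] [Algebra K F] [Ring B] [Algebra K B]

theorem IsSymbolPair.baseChange {q : ℕ} {z a b : K} {u v : B} (h : IsSymbolPair q z a b u v) :
    IsSymbolPair q (algebraMap K F z) (algebraMap K F a) (algebraMap K F b)
      ((1 : F) ⊗ₜ[K] u) ((1 : F) ⊗ₜ[K] v) where
  u_pow := by
    rw [Algebra.TensorProduct.tmul_pow, one_pow, h.u_pow,
      Algebra.TensorProduct.algebraMap_apply, Algebra.algebraMap_self_apply,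
      Algebra.algebraMap_eq_smul_one, Algebra.algebraMap_eq_smul_one, TensorProduct.smul_tmul]
  v_pow := by
    rw [Algebra.TensorProduct.tmul_pow, one_pow, h.v_pow,
      Algebra.TensorProduct.algebraMap_apply, Algebra.algebraMap_self_apply,
      Algebra.algebraMap_eq_smul_one, Algebra.algebraMap_eq_smul_one, TensorProduct.smul_tmul]
  comm := by
    rw [Algebra.TensorProduct.tmul_mul_tmul, Algebra.TensorProduct.tmul_mul_tmul, one_mul, h.comm,
      algebraMap_smul, TensorProduct.tmul_smul]

theorem Algebra.adjoin_one_tmul_eq_top {u v : B} (h : Algebra.adjoin K {u, v} = ⊤) :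
    Algebra.adjoin F {(1 : F) ⊗ₜ[K] u, (1 : F) ⊗ₜ[K] v} = ⊤ := by
  refine Algebra.eq_top_iff.mpr fun x => ?_
  induction x using TensorProduct.induction_on with
  | zero => exact zero_mem _
  | add x y hx hy => exact add_mem hx hy
  | tmul c y =>
    have hc : c ⊗ₜ[K] y = c • ((1 : F) ⊗ₜ[K] y) := by
      rw [TensorProduct.smul_tmul', smul_eq_mul, mul_one]
    rw [hc]
    refine Subalgebra.smul_mem _ ?_ c
    have hy : y ∈ Algebra.adjoin K {u, v} := h ▸ Algebra.mem_top
    have hle : Algebra.adjoin K {u, v} ≤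
        ((Algebra.adjoin F {(1 : F) ⊗ₜ[K] u, (1 : F) ⊗ₜ[K] v}).restrictScalars K).comap
          Algebra.TensorProduct.includeRight := by
      rw [Algebra.adjoin_le_iff]
      rintro _ (rfl | rfl) <;> exact Algebra.subset_adjoin (by simp)
    exact hle hy

end BaseChange

/-! ### Passage from `R` to the completions -/

section Ramification

variable {R : Type u} [CommRing R] [IsDomain R] [IsRegularRing R] (K : Type v) [Field K]
  [Algebra R K] [IsFractionRing R K]

/-- A symbol algebra of prime degree is unramified where its first slot is a unit, if that slot
is a `q`-th power modulo the second slot. -/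
theorem ramificationDivisor_symbolAlgebra_subset {α β : R} (hβ : β ≠ 0) {q : ℕ}
    (hp : q.Prime) (hq : IsUnit (q : R)) {ζ : R} (hζ : IsPrimitiveRoot ζ q)
    (hαβ : ∃ c : R, β ∣ α - c ^ q) :
    ramificationDivisor R K
      (SymbolAlgebra K q (algebraMap R K ζ) (algebraMap R K α) (algebraMap R K β)) ⊆
        divisorOf R K (algebraMap R K α) := by
  rintro x ⟨D, _, _, _, _, hD, A, hA, hne⟩
  by_contra hx
  have hval : (IsDiscreteValuationRing.maximalIdeal (localRingAt R K x)).valuation K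
      (algebraMap R K α) = 1 := not_not.mp hx
  refine hne ?_
  let φ : R →+* CompletedRing (localRingAt R K x) K :=
    (algebraMap (localRingAt R K x) (CompletedRing (localRingAt R K x) K)).comp
      (algebraMap R (localRingAt R K x))
  have hφ : ∀ r, algebraMap (CompletedRing (localRingAt R K x) K)
      (CompletedField (localRingAt R K x) K) (φ r) =
        algebraMap K (CompletedField (localRingAt R K x) K) (algebraMap R K r) := fun r => rfl
  have hinj : Function.Injective φ := by
    have h1 : Function.Injective fun r => algebraMap (CompletedRing (localRingAt R K x) K)
      (CompletedField (localRingAt R K x) K) (φ r) := by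
      simp only [hφ]
      exact (algebraMap K _).injective.comp (IsFractionRing.injective R K)
    exact Function.Injective.of_comp h1
  -- Outside the divisor `α` has valuation `1`, and the completion preserves valuations.
  have hα : IsUnit (φ α) := by
    rw [IsDedekindDomain.HeightOneSpectrum.adicCompletionIntegers.isUnit_iff_valued_eq_one]
    rw [← hval]
    exact IsDedekindDomain.HeightOneSpectrum.valuedAdicCompletion_eq_valuation' _ _
  have hpair := (SymbolAlgebra.isSymbolPair_gen K q (algebraMap R K ζ) (algebraMap R K α)
    (algebraMap R K β)).baseChange (F := CompletedField (localRingAt R K x) K)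
  rw [← hφ, ← hφ, ← hφ] at hpair
  refine residueExtension_eq_bot_of_isSymbolPair hp (by simpa using hq.map φ)
    (hζ.map_of_injective hinj) hα ((map_ne_zero_iff φ hinj).mpr hβ) ?_ hpair
    (Algebra.adjoin_one_tmul_eq_top (SymbolAlgebra.adjoin_gen K q _ _ _)) hD hA
  obtain ⟨c, hc⟩ := hαβ
  exact ⟨φ c, by simpa using map_dvd φ hc⟩

end Ramification

theorem theorem1 {R : Type u} [CommRing R] [IsDomain R] [IsRegularRing R]
    (K : Type v) [Field K] [Algebra R K] [IsFractionRing R K]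
    (α β : R) (hα : α ≠ 0) (hβ : β ≠ 0) :
    (IsUnit (2 : R) → (∃ c : R, β ∣ α - c ^ 2) →
      ramificationDivisor R K (SymbolAlgebra K 2 (-1) (algebraMap R K α) (algebraMap R K β)) ⊆
        divisorOf R K (algebraMap R K α)) ∧
    (∀ q : ℕ, q.Prime → IsUnit (q : R) → ∀ ζ : R, IsPrimitiveRoot ζ q →
      (∃ c : R, β ∣ α - c ^ q) →
      ramificationDivisor R K
          (SymbolAlgebra K q (algebraMap R K ζ) (algebraMap R K α) (algebraMap R K β)) ⊆
        divisorOf R K (algebraMap R K α)) := by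
  refine ⟨fun h2 hc => ?_, fun q hp hq ζ hζ hc =>
    ramificationDivisor_symbolAlgebra_subset K hβ hp hq hζ hc⟩
  -- If `-1 = 1`, the unit `2` would be zero.
  have hζ : IsPrimitiveRoot (-1 : R) 2 := by
    refine IsPrimitiveRoot.mk_of_lt _ two_pos (by norm_num) fun l hl hl2 => ?_
    obtain rfl : l = 1 := by omega
    rw [pow_one]
    intro h
    refine h2.ne_zero ?_
    rw [← one_add_one_eq_two]
    nth_rewrite 1 [← h]
    exact neg_add_cancel 1
  have := ramificationDivisor_symbolAlgebra_subset K hβ Nat.prime_two (by simpa using h2) hζ hc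
  rwa [map_neg, map_one] at this
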